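/- Let $a_1,a_2,b\in\mathbb{C}$ with $b\neq -1,-2,\ldots$, $\operatorname{Re}(b-a_1-a_2)>0$ and $b-a_1-a_2\neq 1,2,\ldots$, and let $$\rho(x)=\frac{(a_1)_x(a_2)_x}{x!\,(b+1)_x},\qquad x=0,1,2,\ldots,$$ be the Hahn weight, where $(a)_x=a(a+1)\cdots(a+x-1)$. Let $L:\mathbb{C}[x]\to\mathbb{C}$ be its moment functional: $L[f]=\sum_{x\ge 0}f(x)\rho(x)$ for those polynomials $f$ for which the series converges absolutely, extended to all polynomials by analytic continuation in the parameters; explicitly, $L$ is the linear functional with $$L[x(x-1)\cdots(x-k+1)]=\Bigl(\sum_{x=0}^{\infty}\rho(x)\Bigr)\frac{(a_1)_k(a_2)_k}{\prod_{j=0}^{k-1}(b-a_1-a_2-j)},\qquad k=0,1,2,\ldots$$ Let $N\in\{0,1,2,\ldots\}\cup\{\infty\}$ and let $P_n$ ($0\le n\le N$, $n<\infty$) be a sequence of monic polynomials with $\deg P_n=n$, orthogonal with respect to $L$: $L[P_nP_m]=h_n\delta_{n,m}$ with $h_n\neq 0$. Let $\beta_n=L[xP_n^2]/h_n$, $\gamma_n=L[xP_nP_{n-1}]/h_{n-1}$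 for $n\ge 1$, and $\gamma_0=0$. Then, for all $n\le N$, $$\beta_n=\frac{(b+2-a_1-a_2)a_1a_2-n(a_1+a_2+b)(n+a_1+a_2-b-1)}{(2n+a_1+a_2-b)(2n+a_1+a_2-b-2)},$$ $$\gamma_n=-n\,\frac{(n+a_1-1)(n+a_2-1)(n+a_1-b-1)}{(2n+a_1+a_2-b-1)(2n+a_1+a_2-b-3)}\cdot\frac{(n+a_2-b-1)(n+a_1+a_2-b-2)}{(2n+a_1+a_2-b-2)^2},$$ and these are the coefficients of the three-term recurrence: $xP_n=P_{n+1}+\beta_nP_n+\gamma_nP_{n-1}$ whenever $n+1\le N$ (with $\gamma_0P_{-1}=0$). -/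

import Mathlib

open Polynomial
open scoped Nat

namespace HahnOP

/-- The Hahn weight `ρ(x) = (a₁)ₓ (a₂)ₓ / (x! (b+1)ₓ)`. -/
noncomputable def weight (a₁ a₂ b : ℂ) (x : ℕ) : ℂ :=
  (ascPochhammer ℂ x).eval a₁ * (ascPochhammer ℂ x).eval a₂ /
    ((x ! : ℂ) * (ascPochhammer ℂ x).eval (b + 1))

/-- The falling factorials `x (x-1) ⋯ (x-k+1)`, as a sequence of polynomials of degree `k`. -/
noncomputable def fallingSeq : Polynomial.Sequence ℂ where
  elems' := descPochhammer ℂ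
  degree_eq' := fun k => by
    rw [degree_eq_natDegree (monic_descPochhammer ℂ k).ne_zero, descPochhammer_natDegree]

theorem isUnit_leadingCoeff_fallingSeq (k : ℕ) : IsUnit (fallingSeq k).leadingCoeff := by
  have h : (fallingSeq k).leadingCoeff = 1 := monic_descPochhammer ℂ k
  rw [h]; exact isUnit_one

/-- The basis of `ℂ[x]` that consists of the falling factorials. -/
noncomputable def fallingBasis : Module.Basis ℕ ℂ ℂ[X] :=
  fallingSeq.basis isUnit_leadingCoeff_fallingSeq

/-- The factorial moment `L[x (x-1) ⋯ (x-k+1)]` of the Hahn weight, namely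
`(∑ₓ ρ(x)) (a₁)ₖ (a₂)ₖ / ∏_{j<k} (b - a₁ - a₂ - j)`. -/
noncomputable def factorialMoment (a₁ a₂ b : ℂ) (k : ℕ) : ℂ :=
  (∑' x : ℕ, weight a₁ a₂ b x) *
    ((ascPochhammer ℂ k).eval a₁ * (ascPochhammer ℂ k).eval a₂ /
      ∏ j ∈ Finset.range k, (b - a₁ - a₂ - (j : ℂ)))

/-- The moment functional `L` of the Hahn weight. It is `L[f] = ∑ₓ f(x) ρ(x)` for every polynomial
`f` for which this series converges absolutely (`hasSum_functional`). The series of a polynomial of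
large degree diverges, unless `a₁` or `a₂` is a nonpositive integer, and its sum is then understood
through analytic continuation in the parameters, which amounts to the factorial moments above;
`L` is also the only linear functional of total mass `∑ₓ ρ(x)` that satisfies
the Pearson equation (`functional_pearson`, `functional_unique`). -/
noncomputable def functional (a₁ a₂ b : ℂ) : ℂ[X] →ₗ[ℂ] ℂ :=
  fallingBasis.constr ℂ (factorialMoment a₁ a₂ b)

/-- `P 0, P 1, …, P N` (all `P n` if `N = ⊤`) is a monic orthogonal polynomial sequence with respect
to the moment functional `L`: `P n` is monic of degree `n` and `L[Pₙ Pₘ] = hₙ δₙₘ` with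
`hₙ ≠ 0`. -/
structure IsMonicOPS (L : ℂ[X] →ₗ[ℂ] ℂ) (N : ℕ∞) (P : ℕ → ℂ[X]) : Prop where
  monic : ∀ n : ℕ, (n : ℕ∞) ≤ N → (P n).Monic
  natDegree_eq : ∀ n : ℕ, (n : ℕ∞) ≤ N → (P n).natDegree = n
  orthogonal : ∀ n m : ℕ, (n : ℕ∞) ≤ N → (m : ℕ∞) ≤ N → n ≠ m → L (P n * P m) = 0
  norm_ne_zero : ∀ n : ℕ, (n : ℕ∞) ≤ N → L (P n * P n) ≠ 0

/-- `βₙ = L[x Pₙ²] / hₙ`. -/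
noncomputable def recBeta (L : ℂ[X] →ₗ[ℂ] ℂ) (P : ℕ → ℂ[X]) (n : ℕ) : ℂ :=
  L (X * P n * P n) / L (P n * P n)

/-- `γₙ = L[x Pₙ Pₙ₋₁] / hₙ₋₁` for `n ≥ 1`, and `γ₀ = 0`. -/
noncomputable def recGamma (L : ℂ[X] →ₗ[ℂ] ℂ) (P : ℕ → ℂ[X]) : ℕ → ℂ
  | 0 => 0
  | n + 1 => L (X * P (n + 1) * P n) / L (P n * P n)

section Agreement

variable {a₁ a₂ b : ℂ}

theorem functional_descPochhammer (a₁ a₂ b : ℂ) (k : ℕ) :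
    functional a₁ a₂ b (descPochhammer ℂ k) = factorialMoment a₁ a₂ b k := by
  have h : descPochhammer ℂ k = fallingBasis k := by
    simp [fallingBasis, fallingSeq]
  rw [h, functional, Module.Basis.constr_basis]

theorem eval_ascPochhammer_ne_zero (hb : ∀ k : ℕ, b ≠ -((k : ℂ) + 1)) (x : ℕ) :
    (ascPochhammer ℂ x).eval (b + 1) ≠ 0 := by
  induction x with
  | zero => simp
  | succ n ih =>
    rw [ascPochhammer_succ_eval]
    refine mul_ne_zero ih fun h => hb n ?_
    linear_combination h

theorem weight_succ (hb : ∀ k : ℕ, b ≠ -((k : ℂ) + 1)) (x : ℕ) :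
    ((x : ℂ) + 1) * (x + 1 + b) * weight a₁ a₂ b (x + 1) =
      (x + a₁) * (x + a₂) * weight a₁ a₂ b x := by
  have h1 := eval_ascPochhammer_ne_zero hb x
  have h2 : b + 1 + (x : ℂ) ≠ 0 := fun h => hb x (by linear_combination h)
  have h3 : ((x ! : ℕ) : ℂ) ≠ 0 := by exact_mod_cast Nat.factorial_ne_zero x
  have h4 : (x : ℂ) + 1 ≠ 0 := by exact_mod_cast Nat.succ_ne_zero x
  simp only [weight, ascPochhammer_succ_eval, Nat.factorial_succ]
  push_cast
  field_simp
  ring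

theorem factorialMoment_succ (hc : ∀ k : ℕ, b - a₁ - a₂ ≠ k) (k : ℕ) :
    (b - a₁ - a₂ - k) * factorialMoment a₁ a₂ b (k + 1) =
      (k + a₁) * (k + a₂) * factorialMoment a₁ a₂ b k := by
  have h1 : b - a₁ - a₂ - (k : ℂ) ≠ 0 := sub_ne_zero.2 (hc k)
  have h2 : ∏ j ∈ Finset.range k, (b - a₁ - a₂ - (j : ℂ)) ≠ 0 :=
    Finset.prod_ne_zero_iff.2 fun j _ => sub_ne_zero.2 (hc j)
  simp only [factorialMoment, ascPochhammer_succ_eval, Finset.prod_range_succ]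
  field_simp
  ring

theorem induction_falling {d : ℕ} {p : ℂ[X] → Prop} (f : ℂ[X]) (hf : f.natDegree ≤ d)
    (hbase : ∀ k ≤ d, p (descPochhammer ℂ k)) (hzero : p 0)
    (hadd : ∀ f g, p f → p g → p (f + g)) (hsmul : ∀ (c : ℂ) f, p f → p (c • f)) : p f := by
  have hmem : f ∈ Submodule.span ℂ (fallingSeq '' Set.Iic d) := by
    rw [fallingSeq.span_degreeLE fun i _ => isUnit_leadingCoeff_fallingSeq i, mem_degreeLE]
    exact degree_le_of_natDegree_le hf
  clear hf
  induction hmem using Submodule.span_induction with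
  | mem x hx =>
    obtain ⟨k, hk, rfl⟩ := hx
    exact hbase k hk
  | zero => exact hzero
  | add x y _ _ hx hy => exact hadd x y hx hy
  | smul c x _ hx => exact hsmul c x hx

/-- The Pearson equation `L[(x+a₁)(x+a₂) f(x)] = L[x(x+b) f(x-1)]`. -/
theorem functional_pearson (hc : ∀ k : ℕ, b - a₁ - a₂ ≠ k) (f : ℂ[X]) :
    functional a₁ a₂ b ((X + C a₁) * (X + C a₂) * f) =
      functional a₁ a₂ b (X * (X + C b) * f.comp (X - 1)) := by
  refine induction_falling (d := f.natDegree) (p := fun f =>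
    functional a₁ a₂ b ((X + C a₁) * (X + C a₂) * f) =
      functional a₁ a₂ b (X * (X + C b) * f.comp (X - 1))) f le_rfl (fun k _ => ?_) ?_ ?_ ?_
  · have h1 : (X + C a₁) * (X + C a₂) * descPochhammer ℂ k =
        descPochhammer ℂ (k + 2) + (2 * (k : ℂ) + 1 + a₁ + a₂) • descPochhammer ℂ (k + 1) +
          ((k + a₁) * (k + a₂)) • descPochhammer ℂ k := by
      rw [descPochhammer_succ_right ℂ (k + 1), descPochhammer_succ_right ℂ k]
      simp only [smul_eq_C_mul, map_add, map_mul, map_one, map_natCast, Nat.cast_add, Nat.cast_one,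
        C_ofNat]
      ring
    have h2 : X * (X + C b) * (descPochhammer ℂ k).comp (X - 1) =
        descPochhammer ℂ (k + 2) + ((k : ℂ) + 1 + b) • descPochhammer ℂ (k + 1) := by
      rw [descPochhammer_succ_right ℂ (k + 1), descPochhammer_succ_left ℂ k]
      simp only [smul_eq_C_mul, map_add, map_one, map_natCast, Nat.cast_add, Nat.cast_one]
      ring
    rw [h1, h2]
    simp only [map_add, map_smul, functional_descPochhammer, smul_eq_mul]
    linear_combination -factorialMoment_succ hc k
  · rw [zero_comp, mul_zero, mul_zero]
  · intro f g hf hg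
    rw [add_comp, mul_add _ f g, mul_add _ (f.comp _), map_add, map_add, hf, hg]
  · intro c f hf
    rw [smul_comp, mul_smul_comm, mul_smul_comm, map_smul, map_smul, hf]

/-- The Pearson equation and the total mass determine the functional. -/
theorem functional_unique (hc : ∀ k : ℕ, b - a₁ - a₂ ≠ k) (L : ℂ[X] →ₗ[ℂ] ℂ)
    (h1 : L 1 = ∑' x : ℕ, weight a₁ a₂ b x)
    (hL : ∀ f : ℂ[X], L ((X + C a₁) * (X + C a₂) * f) = L (X * (X + C b) * f.comp (X - 1))) :
    L = functional a₁ a₂ b := by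
  have key : ∀ k, L (descPochhammer ℂ k) = factorialMoment a₁ a₂ b k := by
    intro k
    induction k with
    | zero => simp [h1, factorialMoment]
    | succ k ih =>
      have h2 : (X + C a₁) * (X + C a₂) * descPochhammer ℂ k -
          X * (X + C b) * (descPochhammer ℂ k).comp (X - 1) =
          ((k + a₁) * (k + a₂)) • descPochhammer ℂ k -
            (b - a₁ - a₂ - k) • descPochhammer ℂ (k + 1) := by
        have e : X * (X + C b) * (descPochhammer ℂ k).comp (X - 1) =
            (X + C b) * (descPochhammer ℂ k * (X - (k : ℂ[X]))) := by
          rw [← descPochhammer_succ_right, descPochhammer_succ_left]; ring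
        rw [e, descPochhammer_succ_right ℂ k]
        simp only [smul_eq_C_mul, map_add, map_sub, map_mul, map_natCast]
        ring
      have h3 := congrArg L h2
      rw [map_sub, hL, sub_self, map_sub, map_smul, map_smul, ih, smul_eq_mul, smul_eq_mul] at h3
      refine mul_left_cancel₀ (sub_ne_zero.2 (hc k)) ?_
      linear_combination h3 - factorialMoment_succ hc k
  refine LinearMap.ext fun f => ?_
  refine induction_falling (d := f.natDegree) (p := fun f => L f = functional a₁ a₂ b f) f le_rfl
    (fun k _ => ?_) ?_ ?_ ?_
  · rw [key, functional_descPochhammer]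
  · rw [map_zero, map_zero]
  · intro f g hf hg
    rw [map_add, map_add, hf, hg]
  · intro c f hf
    rw [map_smul, map_smul, hf]

theorem hasSum_functional_aux (hb : ∀ k : ℕ, b ≠ -((k : ℂ) + 1)) (hc : ∀ k : ℕ, b - a₁ - a₂ ≠ k)
    (d : ℕ) (hS : ∀ j ≤ d, Summable fun x : ℕ => (x : ℂ) ^ j * weight a₁ a₂ b x)
    (hT : ∀ j ≤ d + 1, Filter.Tendsto (fun x : ℕ => (x : ℂ) ^ j * weight a₁ a₂ b x)
      Filter.atTop (nhds 0)) (f : ℂ[X]) (hf : f.natDegree ≤ d) :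
    HasSum (fun x : ℕ => f.eval (x : ℂ) * weight a₁ a₂ b x) (functional a₁ a₂ b f) := by
  have hS' : ∀ f : ℂ[X], f.natDegree ≤ d →
      Summable fun x : ℕ => f.eval (x : ℂ) * weight a₁ a₂ b x := by
    intro f hf
    have : (fun x : ℕ => f.eval (x : ℂ) * weight a₁ a₂ b x) = fun x : ℕ =>
        ∑ j ∈ Finset.range (d + 1), f.coeff j * ((x : ℂ) ^ j * weight a₁ a₂ b x) := by
      funext x
      rw [eval_eq_sum_range' (Nat.lt_succ_of_le hf), Finset.sum_mul]
      exact Finset.sum_congr rfl fun j _ => by ring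
    rw [this]
    exact summable_sum fun j hj =>
      (hS j (Nat.lt_succ_iff.1 (Finset.mem_range.1 hj))).mul_left _
  have hT' : ∀ f : ℂ[X], f.natDegree ≤ d + 1 → Filter.Tendsto
      (fun x : ℕ => f.eval (x : ℂ) * weight a₁ a₂ b x) Filter.atTop (nhds 0) := by
    intro f hf
    have : (fun x : ℕ => f.eval (x : ℂ) * weight a₁ a₂ b x) = fun x : ℕ =>
        ∑ j ∈ Finset.range (d + 2), f.coeff j * ((x : ℂ) ^ j * weight a₁ a₂ b x) := by
      funext x
      rw [eval_eq_sum_range' (Nat.lt_succ_of_le hf), Finset.sum_mul]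
      exact Finset.sum_congr rfl fun j _ => by ring
    rw [this, show (0 : ℂ) = ∑ j ∈ Finset.range (d + 2), f.coeff j * 0 by simp]
    exact tendsto_finsetSum _ fun j hj =>
      (hT j (Nat.lt_succ_iff.1 (Finset.mem_range.1 hj))).const_mul _
  have hbase : ∀ k ≤ d, HasSum (fun x : ℕ => (descPochhammer ℂ k).eval (x : ℂ) * weight a₁ a₂ b x)
      (factorialMoment a₁ a₂ b k) := by
    intro k
    induction k with
    | zero =>
      intro _
      have := (hS 0 (Nat.zero_le _)).hasSum
      simpa [factorialMoment] using this
    | succ k ih =>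
      intro hk
      have ihk := ih (Nat.le_of_succ_le hk)
      have hs1 := hS' (descPochhammer ℂ (k + 1)) (by rw [descPochhammer_natDegree]; exact hk)
      let g : ℕ → ℂ := fun x =>
        ((X + C b) * descPochhammer ℂ (k + 1)).eval (x : ℂ) * weight a₁ a₂ b x
      have hg0 : g 0 = 0 := by simp [g, descPochhammer_ne_zero_eval_zero]
      have hg : Filter.Tendsto g Filter.atTop (nhds 0) := by
        refine hT' _ ?_
        refine natDegree_mul_le.trans ?_
        rw [natDegree_X_add_C, descPochhammer_natDegree]
        omega
      have hdiff : ∀ x : ℕ, g (x + 1) - g x =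
          (k + a₁) * (k + a₂) * ((descPochhammer ℂ k).eval (x : ℂ) * weight a₁ a₂ b x) -
          (b - a₁ - a₂ - k) * ((descPochhammer ℂ (k + 1)).eval (x : ℂ) * weight a₁ a₂ b x) := by
        intro x
        have e1 : (descPochhammer ℂ (k + 1)).eval ((x : ℂ) + 1) =
            (x + 1) * (descPochhammer ℂ k).eval (x : ℂ) := by
          rw [descPochhammer_succ_left]
          simp
        simp only [g, eval_mul, eval_add, eval_X, eval_C, Nat.cast_add, Nat.cast_one, e1]
        simp only [descPochhammer_succ_eval]
        linear_combination (descPochhammer ℂ k).eval (x : ℂ) * weight_succ (a₁ := a₁) (a₂ := a₂) hb x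
      have hsum : HasSum (fun x => g (x + 1) - g x)
          ((k + a₁) * (k + a₂) * factorialMoment a₁ a₂ b k -
            (b - a₁ - a₂ - k) *
              ∑' x : ℕ, (descPochhammer ℂ (k + 1)).eval (x : ℂ) * weight a₁ a₂ b x) := by
        simp only [hdiff]
        exact (ihk.mul_left _).sub (hs1.hasSum.mul_left _)
      have hlim := hsum.tendsto_sum_nat
      simp only [Finset.sum_range_sub, hg0, sub_zero] at hlim
      have h0 := tendsto_nhds_unique hlim hg
      have : (∑' x : ℕ, (descPochhammer ℂ (k + 1)).eval (x : ℂ) * weight a₁ a₂ b x) =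
          factorialMoment a₁ a₂ b (k + 1) := by
        refine mul_left_cancel₀ (sub_ne_zero.2 (hc k)) ?_
        linear_combination -h0 - factorialMoment_succ hc k
      rw [← this]
      exact hs1.hasSum
  refine induction_falling (p := fun f => HasSum (fun x : ℕ => f.eval (x : ℂ) * weight a₁ a₂ b x)
    (functional a₁ a₂ b f)) f hf (fun k hk => ?_) ?_ ?_ ?_
  · rw [functional_descPochhammer]; exact hbase k hk
  · simp
  · intro f g hf hg
    simpa [add_mul] using hf.add hg
  · intro c f hf
    simpa [mul_assoc] using hf.mul_left c

theorem eval_ascPochhammer_eq_prod (s : ℂ) (n : ℕ) :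
    (ascPochhammer ℂ n).eval s = ∏ j ∈ Finset.range n, (s + j) := by
  induction n with
  | zero => simp
  | succ n ih => rw [ascPochhammer_succ_eval, ih, Finset.prod_range_succ]

theorem norm_ascPochhammer_le (s : ℂ) : ∃ K : ℝ, ∀ n : ℕ, 1 ≤ n →
    ‖(ascPochhammer ℂ (n + 1)).eval s‖ ≤ K * ((n : ℝ) ^ s.re * n !) := by
  have hq : ∃ l, Filter.Tendsto
      (fun n : ℕ => ‖(ascPochhammer ℂ (n + 1)).eval s‖ / ((n : ℝ) ^ s.re * n !))
      Filter.atTop (nhds l) := by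
    by_cases hs : ∃ m : ℕ, s = -m
    · obtain ⟨m, rfl⟩ := hs
      refine ⟨0, tendsto_const_nhds.congr' ?_⟩
      filter_upwards [Filter.eventually_ge_atTop m] with n hn
      rw [eval_ascPochhammer_eq_prod, Finset.prod_eq_zero (Finset.mem_range.2 (by omega : m < n + 1))
        (by simp)]
      simp
    · push Not at hs
      refine ⟨_, ((Complex.GammaSeq_tendsto_Gamma s).norm.inv₀
        (norm_ne_zero_iff.2 (Complex.Gamma_ne_zero hs))).congr' ?_⟩
      filter_upwards [Filter.eventually_ge_atTop 1] with n hn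
      rw [Complex.GammaSeq, ← eval_ascPochhammer_eq_prod, norm_div, norm_mul,
        Complex.norm_natCast_cpow_of_pos hn, inv_div, Complex.norm_natCast]
  obtain ⟨l, hl⟩ := hq
  obtain ⟨K, hK⟩ := hl.bddAbove_range
  refine ⟨K, fun n hn => ?_⟩
  have hpos : 0 < (n : ℝ) ^ s.re * (n ! : ℝ) := by
    have : (0 : ℝ) < n := by exact_mod_cast hn
    positivity
  exact (div_le_iff₀ hpos).1 (hK ⟨n, rfl⟩)

theorem norm_inv_ascPochhammer_le (s : ℂ) : ∃ K : ℝ, ∀ n : ℕ, 1 ≤ n →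
    ‖(ascPochhammer ℂ (n + 1)).eval s‖⁻¹ ≤ K / ((n : ℝ) ^ s.re * n !) := by
  obtain ⟨K, hK⟩ := (Complex.GammaSeq_tendsto_Gamma s).norm.bddAbove_range
  refine ⟨K, fun n hn => ?_⟩
  have hpos : 0 < (n : ℝ) ^ s.re * (n ! : ℝ) := by
    have : (0 : ℝ) < n := by exact_mod_cast hn
    positivity
  rw [le_div_iff₀ hpos]
  have h := hK ⟨n, rfl⟩
  simp only [Complex.GammaSeq] at h
  rw [← eval_ascPochhammer_eq_prod, norm_div, norm_mul,
    Complex.norm_natCast_cpow_of_pos hn, Complex.norm_natCast] at h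
  rwa [mul_comm, ← div_eq_mul_inv]

theorem norm_weight_le (a₁ a₂ b : ℂ) : ∃ K : ℝ, ∀ n : ℕ, 1 ≤ n →
    ‖weight a₁ a₂ b (n + 1)‖ ≤ K * (n : ℝ) ^ (-((b - a₁ - a₂).re + 2)) := by
  obtain ⟨K₁, h₁⟩ := norm_ascPochhammer_le a₁
  obtain ⟨K₂, h₂⟩ := norm_ascPochhammer_le a₂
  obtain ⟨K₃, h₃⟩ := norm_inv_ascPochhammer_le (b + 1)
  refine ⟨|K₁| * |K₂| * |K₃|, fun n hn => ?_⟩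
  have hn0 : (0 : ℝ) < n := by exact_mod_cast hn
  have hf : (0 : ℝ) < n ! := by exact_mod_cast Nat.factorial_pos n
  have e1 : ‖(ascPochhammer ℂ (n + 1)).eval a₁‖ ≤ |K₁| * ((n : ℝ) ^ a₁.re * n !) :=
    (h₁ n hn).trans (by gcongr; exact le_abs_self _)
  have e2 : ‖(ascPochhammer ℂ (n + 1)).eval a₂‖ ≤ |K₂| * ((n : ℝ) ^ a₂.re * n !) :=
    (h₂ n hn).trans (by gcongr; exact le_abs_self _)
  have e3 : ‖(ascPochhammer ℂ (n + 1)).eval (b + 1)‖⁻¹ ≤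
      |K₃| / ((n : ℝ) ^ (b + 1).re * n !) :=
    (h₃ n hn).trans (by gcongr; exact le_abs_self _)
  have e4 : ((((n + 1) ! : ℕ) : ℝ))⁻¹ ≤ ((n : ℝ) * n !)⁻¹ := by
    rw [Nat.factorial_succ]
    push_cast
    gcongr
    linarith
  have e5 : (n : ℝ) ^ (-((b - a₁ - a₂).re + 2)) =
      (n : ℝ) ^ a₁.re * (n : ℝ) ^ a₂.re * ((n : ℝ))⁻¹ * ((n : ℝ) ^ (b + 1).re)⁻¹ := by
    rw [← Real.rpow_neg_one, ← Real.rpow_neg hn0.le, ← Real.rpow_add hn0, ← Real.rpow_add hn0,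
      ← Real.rpow_add hn0]
    congr 1
    simp
    ring
  rw [weight, norm_div, norm_mul, norm_mul, Complex.norm_natCast, div_eq_mul_inv, mul_inv]
  calc _ ≤ (|K₁| * ((n : ℝ) ^ a₁.re * n !)) * (|K₂| * ((n : ℝ) ^ a₂.re * n !)) *
        (((n : ℝ) * n !)⁻¹ * (|K₃| / ((n : ℝ) ^ (b + 1).re * n !))) := by gcongr
    _ = _ := by
      rw [e5]
      have : (n : ℝ) ^ (b + 1).re ≠ 0 := (Real.rpow_pos_of_pos hn0 _).ne'
      field_simp

/-- `L[f] = ∑ₓ f(x) ρ(x)` whenever `deg f < Re(b - a₁ - a₂) + 1`, and for all `f` when `a₁` or `a₂`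
is a nonpositive integer, so that the weight has finite support. -/
theorem hasSum_functional (hb : ∀ k : ℕ, b ≠ -((k : ℂ) + 1)) (hc : ∀ k : ℕ, b - a₁ - a₂ ≠ k)
    (f : ℂ[X])
    (h : (f.natDegree : ℝ) < (b - a₁ - a₂).re + 1 ∨ (∃ m : ℕ, a₁ = -m) ∨ ∃ m : ℕ, a₂ = -m) :
    HasSum (fun x : ℕ => f.eval (x : ℂ) * weight a₁ a₂ b x) (functional a₁ a₂ b f) := by
  rcases h with h | h
  · obtain ⟨K, hK⟩ := norm_weight_le a₁ a₂ b
    set r := (b - a₁ - a₂).re with hr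
    have bound : ∀ j n : ℕ, 1 ≤ n → ‖((n + 1 : ℕ) : ℂ) ^ j * weight a₁ a₂ b (n + 1)‖ ≤
        2 ^ j * |K| * (n : ℝ) ^ ((j : ℝ) - r - 2) := by
      intro j n hn
      have hn0 : (0 : ℝ) < n := by exact_mod_cast hn
      have hn1 : (1 : ℝ) ≤ n := by exact_mod_cast hn
      rw [norm_mul, norm_pow, Complex.norm_natCast]
      calc _ ≤ (2 * (n : ℝ)) ^ j * (|K| * (n : ℝ) ^ (-(r + 2))) := by
            have e : ((n + 1 : ℕ) : ℝ) ≤ 2 * n := by push_cast; linarith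
            have e2 : ‖weight a₁ a₂ b (n + 1)‖ ≤ |K| * (n : ℝ) ^ (-(r + 2)) :=
              (hK n hn).trans (by gcongr; exact le_abs_self _)
            gcongr
        _ = _ := by
            rw [mul_pow, show (j : ℝ) - r - 2 = j + -(r + 2) by ring, Real.rpow_add hn0,
              Real.rpow_natCast]
            ring
    refine hasSum_functional_aux hb hc f.natDegree (fun j hj => ?_) (fun j hj => ?_) f le_rfl
    · refine (summable_nat_add_iff 2).1 (Summable.of_norm_bounded
        (g := fun n : ℕ => 2 ^ j * |K| * ((n + 1 : ℕ) : ℝ) ^ ((j : ℝ) - r - 2)) ?_ fun n => ?_)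
      · refine ((summable_nat_add_iff 1).2 (Real.summable_nat_rpow.2 ?_)).mul_left _
        have : (j : ℝ) ≤ f.natDegree := by exact_mod_cast hj
        linarith
      · exact bound j (n + 1) (by omega)
    · rw [← Filter.tendsto_add_atTop_iff_nat 1]
      refine squeeze_zero_norm' (a := fun n : ℕ => 2 ^ j * |K| * (n : ℝ) ^ ((j : ℝ) - r - 2))
        ?_ ?_
      · filter_upwards [Filter.eventually_ge_atTop 1] with n hn using bound j n hn
      · have hlt : 0 < -((j : ℝ) - r - 2) := by
          have : (j : ℝ) ≤ f.natDegree + 1 := by exact_mod_cast hj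
          linarith
        have := (tendsto_rpow_neg_atTop hlt).comp (tendsto_natCast_atTop_atTop (R := ℝ))
        simpa [Function.comp_def] using this.const_mul (2 ^ j * |K|)
  · have hz : ∃ m : ℕ, ∀ x : ℕ, m < x → weight a₁ a₂ b x = 0 := by
      rcases h with ⟨m, rfl⟩ | ⟨m, rfl⟩
      all_goals
        refine ⟨m, fun x hx => ?_⟩
        have : (ascPochhammer ℂ x).eval (-(m : ℂ)) = 0 := by
          rw [eval_ascPochhammer_eq_prod]
          exact Finset.prod_eq_zero (Finset.mem_range.2 hx) (by simp)
        simp [weight, this]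
    obtain ⟨m, hm⟩ := hz
    refine hasSum_functional_aux hb hc f.natDegree (fun j _ => ?_) (fun j _ => ?_) f le_rfl
    · refine summable_of_ne_finset_zero (s := Finset.range (m + 1)) fun x hx => ?_
      rw [hm x (by rw [Finset.mem_range] at hx; omega), mul_zero]
    · refine tendsto_const_nhds.congr' ?_
      filter_upwards [Filter.eventually_gt_atTop m] with x hx
      rw [hm x hx, mul_zero]

end Agreement

end HahnOP

/-! Put `c = b - a₁ - a₂` and `φₖ = x(x-1)⋯(x-k+1)`. The Pearson equation `functional_pearson` acts
as summation by parts, so the second-order difference operator `diffOp` is symmetric for `L`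
(`functional_diffOp_symm`). In the basis `φₖ` this operator is bidiagonal, with diagonal entries `λₙ
= n(n-1-c)`. The hypotheses on `c` say that `c` is not an integer, and since `λₙ - λₘ =
(n-m)(n+m-1-c)` the eigenvalues are distinct. Hence there is a monic eigenpolynomial `Hₙ`
(`hahnPoly`) of each degree, given by explicit coefficients, and the `Hₙ` are pairwise orthogonal.

Nonvanishing of the norms makes a monic orthogonal sequence unique, so `Pₙ = Hₙ` for `n ≤ N`
(`IsMonicOPS.eq_hahnPoly`). The numbers `βₙ`, `γₙ` are then read off the three leading coefficients
of `Hₙ` and `Hₙ₊₁`: with the stated values, `xHₙ - Hₙ₊₁ - βₙHₙ - γₙHₙ₋₁` has degree less than `n-1`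
(`degree_remainder_lt`). Pairing this remainder with `Hₙ` and `Hₙ₋₁` identifies the coefficients,
and nondegeneracy of `L` in low degrees makes the remainder vanish. -/

namespace HahnOP

/-! ### Orthogonality and nondegeneracy for a general linear functional. -/

section Orthogonality

variable {L : ℂ[X] →ₗ[ℂ] ℂ} {P : ℕ → ℂ[X]}

theorem degree_sub_C_mul_lt {p f : ℂ[X]} {m : ℕ} (hp : p.Monic) (hd : p.natDegree = m)
    (hf : f.natDegree ≤ m) : (f - C (f.coeff m) * p).degree < m := by
  refine (degree_lt_iff_coeff_zero _ _).2 fun k hk => ?_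
  rcases hk.eq_or_lt with rfl | hk
  · have : p.coeff m = 1 := by rw [← hd]; exact hp
    simp [this]
  · rw [coeff_sub, coeff_C_mul, coeff_eq_zero_of_natDegree_lt (hf.trans_lt hk),
      coeff_eq_zero_of_natDegree_lt (hd.trans_lt hk), mul_zero, sub_zero]

/-- A polynomial orthogonal to `P 0, …, P (n - 1)` is orthogonal to all polynomials of degree less
than `n`. -/
theorem orthogonal_of_degree_lt {g : ℂ[X]} {n : ℕ} (hP : ∀ m < n, (P m).Monic)
    (hd : ∀ m < n, (P m).natDegree = m) (hg : ∀ m < n, L (g * P m) = 0) {f : ℂ[X]}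
    (hf : f.degree < n) : L (g * f) = 0 := by
  induction n generalizing f with
  | zero =>
    have : f = 0 := by simpa [Nat.WithBot.lt_zero_iff] using hf
    simp [this]
  | succ n ih =>
    have hf' : f.natDegree ≤ n := natDegree_le_iff_coeff_eq_zero.2 fun k hk =>
      (degree_lt_iff_coeff_zero _ _).1 hf k hk
    have h1 := ih (fun m hm => hP m (by omega)) (fun m hm => hd m (by omega))
      (fun m hm => hg m (by omega))
      (degree_sub_C_mul_lt (hP n n.lt_succ_self) (hd n n.lt_succ_self) hf')
    rw [mul_sub, map_sub, mul_left_comm, ← smul_eq_C_mul, map_smul, hg n n.lt_succ_self, smul_zero,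
      sub_zero] at h1
    exact h1

/-- A polynomial of degree less than `n` orthogonal to the quasi-definite sequence
`P 0, …, P (n - 1)` vanishes. -/
theorem eq_zero_of_orthogonal {n : ℕ} (hP : ∀ m < n, (P m).Monic)
    (hd : ∀ m < n, (P m).natDegree = m) (ho : ∀ i < n, ∀ j < n, i ≠ j → L (P i * P j) = 0)
    (hn : ∀ m < n, L (P m * P m) ≠ 0) {f : ℂ[X]} (hf : f.degree < n)
    (h : ∀ m < n, L (f * P m) = 0) : f = 0 := by
  by_contra hf0
  have hm : f.natDegree < n := (natDegree_lt_iff_degree_lt hf0).2 hf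
  -- With `m = deg f`, the polynomial `f - lead(f) Pₘ` has degree less than `m`, so pairing it with
  -- `Pₘ` gives `0 = L[f Pₘ] = lead(f) hₘ`.
  have h1 := orthogonal_of_degree_lt (L := L) (P := P) (g := P f.natDegree)
    (fun m hm' => hP m (by omega)) (fun m hm' => hd m (by omega))
    (fun m hm' => ho _ hm m (by omega) (by omega))
    (degree_sub_C_mul_lt (hP _ hm) (hd _ hm) le_rfl)
  rw [mul_sub, map_sub, mul_comm, h _ hm, mul_left_comm, ← smul_eq_C_mul, map_smul, zero_sub,
    neg_eq_zero, smul_eq_zero] at h1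
  exact h1.elim (fun h => hf0 (leadingCoeff_eq_zero.1 h)) (hn _ hm)

end Orthogonality

/-! ### The symmetric difference operator and its bidiagonal matrix. -/

section DifferenceOperator

variable {a₁ a₂ b : ℂ}

/-- The difference operator
`f ↦ (x+a₁)(x+a₂)(f(x+1) - f(x)) + x(x+b)(f(x-1) - f(x))` of the Hahn weight. -/
noncomputable def diffOp (a₁ a₂ b : ℂ) : ℂ[X] →ₗ[ℂ] ℂ[X] where
  toFun f := (X + C a₁) * (X + C a₂) * (f.comp (X + 1) - f) + X * (X + C b) * (f.comp (X - 1) - f)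
  map_add' f g := by simp only [add_comp]; ring
  map_smul' c f := by simp only [smul_eq_C_mul, mul_comp, C_comp, RingHom.id_apply]; ring

/-- Summation by parts: the Pearson equation for `g(x+1)(f(x) - f(x+1))` turns the backward
difference in `diffOp` into a forward one. The resulting form is visibly symmetric in `f` and `g`.
-/
theorem functional_mul_diffOp (hc : ∀ k : ℕ, b - a₁ - a₂ ≠ k) (f g : ℂ[X]) :
    functional a₁ a₂ b (g * diffOp a₁ a₂ b f) =
      -functional a₁ a₂ b ((X + C a₁) * (X + C a₂) *
        ((g.comp (X + 1) - g) * (f.comp (X + 1) - f))) := by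
  have h := functional_pearson hc (g.comp (X + 1) * (f - f.comp (X + 1)))
  have e : ∀ p : ℂ[X], (p.comp (X + 1)).comp (X - 1) = p := fun p => by
    rw [comp_assoc]; simp
  rw [mul_comp, sub_comp, e, e] at h
  rw [← map_neg, ← sub_eq_zero]
  have h' := sub_eq_zero.2 h.symm
  rw [← map_sub] at h' ⊢
  rw [← h']
  congr 1
  simp only [diffOp, LinearMap.coe_mk, AddHom.coe_mk]
  ring

/-- The difference operator is symmetric with respect to the moment functional. -/
theorem functional_diffOp_symm (hc : ∀ k : ℕ, b - a₁ - a₂ ≠ k) (f g : ℂ[X]) :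
    functional a₁ a₂ b (g * diffOp a₁ a₂ b f) = functional a₁ a₂ b (f * diffOp a₁ a₂ b g) := by
  rw [functional_mul_diffOp hc, functional_mul_diffOp hc, mul_comm (g.comp _ - g)]

theorem descPochhammer_comp_X_add_one (k : ℕ) :
    (descPochhammer ℂ (k + 1)).comp (X + 1) =
      descPochhammer ℂ (k + 1) + (k + 1 : ℂ[X]) * descPochhammer ℂ k := by
  have e : (descPochhammer ℂ (k + 1)).comp (X + 1) = (X + 1) * descPochhammer ℂ k := by
    rw [descPochhammer_succ_left, mul_comp, comp_assoc]; simp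
  rw [e, descPochhammer_succ_right]
  ring

theorem X_mul_descPochhammer_comp (k : ℕ) :
    X * (descPochhammer ℂ k).comp (X - 1) = (X - (k : ℂ[X])) * descPochhammer ℂ k := by
  rw [← descPochhammer_succ_left, descPochhammer_succ_right, mul_comm]

theorem diffOp_one : diffOp a₁ a₂ b 1 = 0 := by
  simp [diffOp]

/-- Forward differences lower `φₖ₊₁` to `(k+1)φₖ`, and the factor `x` absorbs the backward shift:
`x(φₖ₊₁(x-1) - φₖ₊₁(x)) = -(k+1)φₖ₊₁`. What remains is `(k+1)φₖ` times `(x+a₁)(x+a₂) - (x+b)(x-k)`,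
in which the quadratic terms cancel. -/
theorem diffOp_descPochhammer_succ (k : ℕ) :
    diffOp a₁ a₂ b (descPochhammer ℂ (k + 1)) =
      (((k : ℂ) + 1) * (k - (b - a₁ - a₂))) • descPochhammer ℂ (k + 1) +
        (((k : ℂ) + 1) * (k + a₁) * (k + a₂)) • descPochhammer ℂ k := by
  have e1 := X_mul_descPochhammer_comp (k + 1)
  simp only [diffOp, LinearMap.coe_mk, AddHom.coe_mk, descPochhammer_comp_X_add_one]
  rw [show X * (X + C b) * ((descPochhammer ℂ (k + 1)).comp (X - 1) - descPochhammer ℂ (k + 1)) =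
    (X + C b) * (X * (descPochhammer ℂ (k + 1)).comp (X - 1) - X * descPochhammer ℂ (k + 1)) by
    ring, e1, descPochhammer_succ_right]
  simp only [smul_eq_C_mul, map_add, map_sub, map_mul, map_one, map_natCast, Nat.cast_add,
    Nat.cast_one]
  ring

end DifferenceOperator

/-! ### Monic eigenpolynomials, their orthogonality and uniqueness. -/

section HahnPolynomial

variable {a₁ a₂ b : ℂ}

/-- The coefficient of the falling factorial of degree `n - i` in the monic Hahn polynomial of
degree `n`. -/
noncomputable def hahnCoeff (a₁ a₂ b : ℂ) (n : ℕ) : ℕ → ℂ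
  | 0 => 1
  | i + 1 => hahnCoeff a₁ a₂ b n i *
      ((n - i) * (n - i - 1 + a₁) * (n - i - 1 + a₂) / ((i + 1) * (2 * n - i - 2 - (b - a₁ - a₂))))

/-- The monic Hahn polynomial of degree `n`. -/
noncomputable def hahnPoly (a₁ a₂ b : ℂ) (n : ℕ) : ℂ[X] :=
  ∑ i ∈ Finset.range (n + 1), hahnCoeff a₁ a₂ b n i • descPochhammer ℂ (n - i)

theorem hahnCoeff_eq_zero {n i : ℕ} (h : n < i) : hahnCoeff a₁ a₂ b n i = 0 := by
  obtain ⟨d, rfl⟩ := Nat.exists_eq_add_of_lt h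
  induction d with
  | zero => simp [hahnCoeff]
  | succ d ih =>
    rw [← add_assoc, hahnCoeff, ih (by omega), zero_mul]

theorem degree_descPochhammer (k : ℕ) : (descPochhammer ℂ k).degree = k := by
  rw [degree_eq_natDegree (monic_descPochhammer ℂ k).ne_zero, descPochhammer_natDegree]

theorem hahnPoly_eq (a₁ a₂ b : ℂ) (n : ℕ) : ∃ r : ℂ[X], r.degree < n ∧
    hahnPoly a₁ a₂ b n = descPochhammer ℂ n + r := by
  refine ⟨∑ i ∈ Finset.range n, hahnCoeff a₁ a₂ b n (i + 1) • descPochhammer ℂ (n - (i + 1)),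
    ?_, ?_⟩
  · refine mem_degreeLT.1 (Submodule.sum_mem _ fun i hi => Submodule.smul_mem _ _
      (mem_degreeLT.2 ?_))
    rw [degree_descPochhammer]
    have := Finset.mem_range.1 hi
    exact_mod_cast (by omega : n - (i + 1) < n)
  · rw [hahnPoly, Finset.sum_range_succ', add_comm]
    simp [hahnCoeff]

/-- Only the three leading coefficients enter the recurrence; everything below goes into `r`. -/
theorem hahnPoly_add_two_eq (a₁ a₂ b : ℂ) (n : ℕ) : ∃ r : ℂ[X], r.degree < n ∧
    hahnPoly a₁ a₂ b (n + 2) = descPochhammer ℂ (n + 2) +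
      hahnCoeff a₁ a₂ b (n + 2) 1 • descPochhammer ℂ (n + 1) +
      hahnCoeff a₁ a₂ b (n + 2) 2 • descPochhammer ℂ n + r := by
  refine ⟨∑ i ∈ Finset.range n,
    hahnCoeff a₁ a₂ b (n + 2) (i + 3) • descPochhammer ℂ (n + 2 - (i + 3)), ?_, ?_⟩
  · refine mem_degreeLT.1 (Submodule.sum_mem _ fun i hi => Submodule.smul_mem _ _
      (mem_degreeLT.2 ?_))
    rw [degree_descPochhammer]
    have := Finset.mem_range.1 hi
    exact_mod_cast (by omega : n + 2 - (i + 3) < n)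
  · rw [hahnPoly, Finset.sum_range_succ', Finset.sum_range_succ', Finset.sum_range_succ']
    simp only [add_assoc, Nat.reduceAdd, zero_add]
    rw [show n + 2 - 2 = n by omega, show n + 2 - 1 = n + 1 by omega, hahnCoeff]
    simp only [Nat.sub_zero, one_smul]
    abel

theorem monic_hahnPoly (n : ℕ) : (hahnPoly a₁ a₂ b n).Monic := by
  obtain ⟨r, hr, h⟩ := hahnPoly_eq a₁ a₂ b n
  rw [h]
  exact (monic_descPochhammer ℂ n).add_of_left (by rwa [degree_descPochhammer])

theorem natDegree_hahnPoly (n : ℕ) : (hahnPoly a₁ a₂ b n).natDegree = n := by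
  obtain ⟨r, hr, h⟩ := hahnPoly_eq a₁ a₂ b n
  rw [h]
  refine natDegree_eq_of_degree_eq_some ?_
  rw [degree_add_eq_left_of_degree_lt (by rwa [degree_descPochhammer]), degree_descPochhammer]

/-- This is the coefficient of `φₙ₋ᵢ₋₁` in the eigenvalue equation; the factor on the left is `λₙ -
λₙ₋ᵢ₋₁`, nonzero for `i < n` because `c` is not an integer. -/
theorem hahnCoeff_succ (hc : ∀ k : ℤ, b - a₁ - a₂ ≠ k) (n i : ℕ) :
    (i + 1) * (2 * n - i - 2 - (b - a₁ - a₂)) * hahnCoeff a₁ a₂ b n (i + 1) =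
      (n - i) * (n - i - 1 + a₁) * (n - i - 1 + a₂) * hahnCoeff a₁ a₂ b n i := by
  have h1 : (i : ℂ) + 1 ≠ 0 := by exact_mod_cast i.succ_ne_zero
  have h2 : (2 * n - i - 2 - (b - a₁ - a₂) : ℂ) ≠ 0 := fun h =>
    hc (2 * n - i - 2) (by push_cast; linear_combination -h)
  rw [hahnCoeff]
  field_simp

/-- The Hahn polynomials are eigenfunctions of the difference operator. -/
theorem diffOp_hahnPoly (hc : ∀ k : ℤ, b - a₁ - a₂ ≠ k) (n : ℕ) :
    diffOp a₁ a₂ b (hahnPoly a₁ a₂ b n) =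
      ((n : ℂ) * (n - 1 - (b - a₁ - a₂))) • hahnPoly a₁ a₂ b n := by
  -- A partial sum satisfies the eigenvalue equation up to a single defect, `λₙ - λₙ₋ₘ` times the
  -- next term of the sum; adding that term moves the defect one degree down.
  have key : ∀ m ≤ n, diffOp a₁ a₂ b
      (∑ i ∈ Finset.range m, hahnCoeff a₁ a₂ b n i • descPochhammer ℂ (n - i)) =
      ((n : ℂ) * (n - 1 - (b - a₁ - a₂))) •
        (∑ i ∈ Finset.range m, hahnCoeff a₁ a₂ b n i • descPochhammer ℂ (n - i)) +
      (m * (2 * n - m - 1 - (b - a₁ - a₂)) * hahnCoeff a₁ a₂ b n m) •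
        descPochhammer ℂ (n - m) := by
    intro m
    induction m with
    | zero => simp
    | succ m ih =>
      intro hm
      obtain ⟨k, rfl⟩ := Nat.exists_eq_add_of_le' hm
      have e1 : k + (m + 1) - m = k + 1 := by omega
      have e2 : k + (m + 1) - (m + 1) = k := by omega
      have h := hahnCoeff_succ hc (k + (m + 1)) m
      rw [Finset.sum_range_succ, map_add, ih (by omega), map_smul, e1, e2,
        diffOp_descPochhammer_succ, smul_add, smul_add]
      have h' : ((m + 1 : ℕ) * (2 * (k + (m + 1) : ℕ) - (m + 1 : ℕ) - 1 - (b - a₁ - a₂)) *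
          hahnCoeff a₁ a₂ b (k + (m + 1)) (m + 1) : ℂ) =
          hahnCoeff a₁ a₂ b (k + (m + 1)) m * (((k : ℂ) + 1) * (k + a₁) * (k + a₂)) := by
        push_cast at h ⊢
        linear_combination h
      rw [h']
      simp only [smul_smul, add_assoc]
      congr 1
      rw [← add_assoc, ← add_smul]
      congr 2
      push_cast
      ring
  have hn := key n le_rfl
  -- The last term is constant, so `diffOp` kills it, while the defect at `m = n` is exactly `λₙ`
  -- times it.
  rw [hahnPoly, Finset.sum_range_succ, map_add, hn, map_smul, Nat.sub_self, descPochhammer_zero,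
    diffOp_one, smul_zero, add_zero, smul_add, smul_smul]
  congr 2
  ring

/-- The Hahn polynomials are pairwise orthogonal. -/
theorem functional_hahnPoly_mul (hc : ∀ k : ℤ, b - a₁ - a₂ ≠ k) {n m : ℕ} (h : n ≠ m) :
    functional a₁ a₂ b (hahnPoly a₁ a₂ b n * hahnPoly a₁ a₂ b m) = 0 := by
  have h1 := functional_diffOp_symm (fun k => by exact_mod_cast hc k) (hahnPoly a₁ a₂ b n)
    (hahnPoly a₁ a₂ b m)
  rw [diffOp_hahnPoly hc, diffOp_hahnPoly hc, mul_smul_comm, mul_smul_comm, map_smul, map_smul,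
    mul_comm (hahnPoly a₁ a₂ b m), smul_eq_mul, smul_eq_mul] at h1
  -- `h2` and `h3` concern the two factors of `λₙ - λₘ`.
  have h2 : (n : ℂ) - m ≠ 0 := sub_ne_zero.2 (by exact_mod_cast h)
  have h3 : (n : ℂ) + m - 1 - (b - a₁ - a₂) ≠ 0 := fun h =>
    hc (n + m - 1) (by push_cast; linear_combination -h)
  refine mul_left_cancel₀ (mul_ne_zero h2 h3) ?_
  linear_combination h1

theorem functional_hahnPoly_mul_of_degree_lt (hc : ∀ k : ℤ, b - a₁ - a₂ ≠ k) {n : ℕ} {f : ℂ[X]}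
    (hf : f.degree < n) : functional a₁ a₂ b (hahnPoly a₁ a₂ b n * f) = 0 :=
  orthogonal_of_degree_lt (P := hahnPoly a₁ a₂ b) (fun m _ => monic_hahnPoly m)
    (fun m _ => natDegree_hahnPoly m) (fun _ hm => functional_hahnPoly_mul hc hm.ne') hf

/-- Both polynomials are monic and orthogonal to all lower degrees, so their difference has degree
less than `n` and is orthogonal to `P₀, …, Pₙ₋₁`. Only norms of index below `n` are used, so no norm
of `Hₙ` has to be computed. -/
theorem IsMonicOPS.eq_hahnPoly (hc : ∀ k : ℤ, b - a₁ - a₂ ≠ k) {N : ℕ∞} {P : ℕ → ℂ[X]}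
    (hP : IsMonicOPS (functional a₁ a₂ b) N P) {n : ℕ} (hn : (n : ℕ∞) ≤ N) :
    P n = hahnPoly a₁ a₂ b n := by
  have hle : ∀ m < n, (m : ℕ∞) ≤ N := fun m hm => le_trans (by exact_mod_cast hm.le) hn
  refine sub_eq_zero.1 (eq_zero_of_orthogonal (L := functional a₁ a₂ b) (P := P) (n := n)
    (fun m hm => hP.monic m (hle m hm)) (fun m hm => hP.natDegree_eq m (hle m hm))
    (fun i hi j hj hij => hP.orthogonal i j (hle i hi) (hle j hj) hij)
    (fun m hm => hP.norm_ne_zero m (hle m hm)) ?_ fun m hm => ?_)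
  · have h := degree_sub_C_mul_lt (monic_hahnPoly (a₁ := a₁) (a₂ := a₂) (b := b) n)
      (natDegree_hahnPoly n) (hP.natDegree_eq n hn).le
    have h1 : (P n).coeff n = 1 := by
      have := hP.monic n hn
      rwa [Monic, leadingCoeff, hP.natDegree_eq n hn] at this
    rwa [h1, map_one, one_mul] at h
  · have h1 : (P m).degree < n := by
      rw [degree_eq_natDegree (hP.monic m (hle m hm)).ne_zero, hP.natDegree_eq m (hle m hm)]
      exact_mod_cast hm
    rw [sub_mul, map_sub, hP.orthogonal n m hn (hle m hm) hm.ne',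
      functional_hahnPoly_mul_of_degree_lt hc h1, sub_zero]

end HahnPolynomial

/-! ### Recurrence coefficients from the leading coefficients. -/

section Recurrence

/-- The diagonal recurrence coefficient of the Hahn polynomials. -/
noncomputable def hahnBeta (a₁ a₂ b : ℂ) (n : ℕ) : ℂ :=
  ((b + 2 - a₁ - a₂) * a₁ * a₂ - n * (a₁ + a₂ + b) * (n + a₁ + a₂ - b - 1)) /
    ((2 * n + a₁ + a₂ - b) * (2 * n + a₁ + a₂ - b - 2))

/-- The lower recurrence coefficient of the Hahn polynomials. -/
noncomputable def hahnGamma (a₁ a₂ b : ℂ) (n : ℕ) : ℂ :=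
  -n * ((n + a₁ - 1) * (n + a₂ - 1) * (n + a₁ - b - 1) /
      ((2 * n + a₁ + a₂ - b - 1) * (2 * n + a₁ + a₂ - b - 3))) *
    ((n + a₂ - b - 1) * (n + a₁ + a₂ - b - 2) / (2 * n + a₁ + a₂ - b - 2) ^ 2)

variable {a₁ a₂ b : ℂ}

theorem denominator_ne_zero (hc : ∀ k : ℤ, b - a₁ - a₂ ≠ k) (n : ℕ) (k : ℤ) :
    (2 * n + a₁ + a₂ - b - k : ℂ) ≠ 0 := fun h =>
  hc (2 * n - k) (by push_cast; linear_combination -h)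

/-- Since `xφₖ = φₖ₊₁ + kφₖ`, the right-hand side is the coefficient of `φₙ` in `xHₙ - Hₙ₊₁`. -/
theorem hahnBeta_eq (hc : ∀ k : ℤ, b - a₁ - a₂ ≠ k) (n : ℕ) :
    hahnBeta a₁ a₂ b n = hahnCoeff a₁ a₂ b n 1 + n - hahnCoeff a₁ a₂ b (n + 1) 1 := by
  have h0 := denominator_ne_zero hc n 0
  have h2 := denominator_ne_zero hc n 2
  push_cast at h0 h2
  rw [sub_zero] at h0
  simp only [hahnBeta, hahnCoeff]
  push_cast
  rw [show (2 * n - 0 - 2 - (b - a₁ - a₂) : ℂ) = 2 * n + a₁ + a₂ - b - 2 by ring,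
    show (2 * (n + 1) - 0 - 2 - (b - a₁ - a₂) : ℂ) = 2 * n + a₁ + a₂ - b by ring]
  field_simp
  ring

/-- For `n ≥ 1` the right-hand side is the coefficient of `φₙ₋₁` in `xHₙ - Hₙ₊₁ - βₙHₙ`. -/
theorem hahnGamma_eq (hc : ∀ k : ℤ, b - a₁ - a₂ ≠ k) (n : ℕ) :
    hahnGamma a₁ a₂ b n = hahnCoeff a₁ a₂ b n 2 + (n - 1) * hahnCoeff a₁ a₂ b n 1 -
      hahnCoeff a₁ a₂ b (n + 1) 2 - hahnBeta a₁ a₂ b n * hahnCoeff a₁ a₂ b n 1 := by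
  have h0 := denominator_ne_zero hc n 0
  have h1 := denominator_ne_zero hc n 1
  have h2 := denominator_ne_zero hc n 2
  have h3 := denominator_ne_zero hc n 3
  push_cast at h0 h1 h2 h3
  rw [sub_zero] at h0
  simp only [hahnGamma, hahnBeta, hahnCoeff]
  push_cast
  generalize (n : ℂ) = x at *
  -- Trading `b` for `d = 2n + a₁ + a₂ - b - 2` turns all denominators into `d - 1`, `d`, `d + 1`,
  -- `d + 2`, up to numerical factors.
  obtain ⟨d, rfl⟩ : ∃ d, b = 2 * x + a₁ + a₂ - 2 - d := ⟨2 * x + a₁ + a₂ - 2 - b, by ring⟩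
  ring_nf at h0 h1 h2 h3
  rw [show 2 * x - 0 - 2 - (2 * x + a₁ + a₂ - 2 - d - a₁ - a₂) = d by ring,
    show 2 * x - 1 - 2 - (2 * x + a₁ + a₂ - 2 - d - a₁ - a₂) = -1 + d by ring,
    show 2 * (x + 1) - 0 - 2 - (2 * x + a₁ + a₂ - 2 - d - a₁ - a₂) = 2 + d by ring,
    show 2 * (x + 1) - 1 - 2 - (2 * x + a₁ + a₂ - 2 - d - a₁ - a₂) = 1 + d by ring,
    show 2 * x + a₁ + a₂ - (2 * x + a₁ + a₂ - 2 - d) = 2 + d by ring]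
  rw [show 2 + d - 1 = 1 + d by ring, show 2 + d - 2 = d by ring, show 2 + d - 3 = -1 + d by ring]
  field_simp
  ring

theorem X_mul_descPochhammer (k : ℕ) :
    X * descPochhammer ℂ k = descPochhammer ℂ (k + 1) + (k : ℂ) • descPochhammer ℂ k := by
  rw [descPochhammer_succ_right, smul_eq_C_mul, map_natCast]
  ring

theorem hahnPoly_zero : hahnPoly a₁ a₂ b 0 = 1 := by
  simp [hahnPoly, hahnCoeff]

theorem hahnPoly_one :
    hahnPoly a₁ a₂ b 1 = descPochhammer ℂ 1 + hahnCoeff a₁ a₂ b 1 1 • descPochhammer ℂ 0 := by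
  simp [hahnPoly, Finset.sum_range_succ, hahnCoeff]

theorem X_mul_hahnPoly_zero (hc : ∀ k : ℤ, b - a₁ - a₂ ≠ k) :
    X * hahnPoly a₁ a₂ b 0 =
      hahnPoly a₁ a₂ b 1 + C (hahnBeta a₁ a₂ b 0) * hahnPoly a₁ a₂ b 0 := by
  have h : hahnCoeff a₁ a₂ b 0 1 = 0 := hahnCoeff_eq_zero one_pos
  rw [hahnBeta_eq hc, hahnPoly_zero, hahnPoly_one, h, smul_eq_C_mul]
  simp

/-- The remainder of the three-term recurrence has degree less than `n`. -/
theorem degree_remainder_lt (hc : ∀ k : ℤ, b - a₁ - a₂ ≠ k) (n : ℕ) :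
    (X * hahnPoly a₁ a₂ b (n + 1) - hahnPoly a₁ a₂ b (n + 2) -
      C (hahnBeta a₁ a₂ b (n + 1)) * hahnPoly a₁ a₂ b (n + 1) -
      C (hahnGamma a₁ a₂ b (n + 1)) * hahnPoly a₁ a₂ b n).degree < (n : WithBot ℕ) := by
  have hβ := hahnBeta_eq hc (n + 1)
  have hγ := hahnGamma_eq hc (n + 1)
  cases n with
  | zero =>
    obtain ⟨r, hr, h⟩ := hahnPoly_add_two_eq a₁ a₂ b 0
    -- Here degree less than `0` means zero, so the recurrence has to hold exactly.
    have hr0 : r = 0 := by simpa [Nat.WithBot.lt_zero_iff] using hr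
    have h2 : hahnCoeff a₁ a₂ b 1 2 = 0 := hahnCoeff_eq_zero one_lt_two
    have hX0 := X_mul_descPochhammer 0
    have hX1 := X_mul_descPochhammer 1
    suffices hz : X * hahnPoly a₁ a₂ b 1 - hahnPoly a₁ a₂ b 2 -
        C (hahnBeta a₁ a₂ b 1) * hahnPoly a₁ a₂ b 1 -
        C (hahnGamma a₁ a₂ b 1) * hahnPoly a₁ a₂ b 0 = 0 by
      simp only [zero_add]; rw [hz]; simp
    simp only [zero_add, Nat.reduceAdd] at h hβ hγ hX0 hX1
    rw [hγ, hβ, hahnPoly_one, h, hr0, h2, hahnPoly_zero, ← descPochhammer_zero ℂ]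
    simp only [smul_eq_C_mul] at hX0 hX1 ⊢
    simp only [map_add, map_sub, map_mul, map_one, map_zero, Nat.cast_one, Nat.cast_zero,
      zero_mul, one_mul] at hX0 hX1 ⊢
    linear_combination hX1 + C (hahnCoeff a₁ a₂ b 1 1) * hX0
  | succ n =>
    obtain ⟨r, hr, h⟩ := hahnPoly_add_two_eq a₁ a₂ b n
    obtain ⟨s, hs, h'⟩ := hahnPoly_add_two_eq a₁ a₂ b (n + 1)
    obtain ⟨t, ht, h''⟩ := hahnPoly_eq a₁ a₂ b (n + 1)
    have hX0 := X_mul_descPochhammer n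
    have hX1 := X_mul_descPochhammer (n + 1)
    have hX2 := X_mul_descPochhammer (n + 2)
    rw [show n + 1 + 1 = n + 2 by omega] at *
    rw [show n + 1 + 2 = n + 3 by omega] at *
    rw [show n + 2 + 1 = n + 3 by omega] at *
    -- The terms in `φₙ₊₃`, `φₙ₊₂`, `φₙ₊₁` cancel by monicity, `hahnBeta_eq` and `hahnGamma_eq`
    -- respectively; the right-hand side collects what is left, all of degree at most `n`.
    suffices hz : X * hahnPoly a₁ a₂ b (n + 2) - hahnPoly a₁ a₂ b (n + 3) -
        C (hahnBeta a₁ a₂ b (n + 2)) * hahnPoly a₁ a₂ b (n + 2) -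
        C (hahnGamma a₁ a₂ b (n + 2)) * hahnPoly a₁ a₂ b (n + 1) =
        (hahnCoeff a₁ a₂ b (n + 2) 2 * (n - hahnBeta a₁ a₂ b (n + 2))) • descPochhammer ℂ n +
          X * r - s - hahnBeta a₁ a₂ b (n + 2) • r - hahnGamma a₁ a₂ b (n + 2) • t by
      have hr' : r ∈ degreeLT ℂ (n + 1) :=
        mem_degreeLT.2 (hr.trans (by exact_mod_cast n.lt_succ_self))
      have hXr : X * r ∈ degreeLT ℂ (n + 1) := by
        rw [mem_degreeLT, degree_lt_iff_coeff_zero]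
        rintro (_ | k) hk
        · omega
        · rw [coeff_X_mul]
          exact (degree_lt_iff_coeff_zero _ _).1 hr k (by omega)
      have hφ : descPochhammer ℂ n ∈ degreeLT ℂ (n + 1) := by
        rw [mem_degreeLT, degree_descPochhammer]
        exact_mod_cast n.lt_succ_self
      rw [hz]
      exact mem_degreeLT.1 (Submodule.sub_mem _ (Submodule.sub_mem _ (Submodule.sub_mem _
        (Submodule.add_mem _ (Submodule.smul_mem _ _ hφ) hXr) (mem_degreeLT.2 hs))
        (Submodule.smul_mem _ _ hr')) (Submodule.smul_mem _ _ (mem_degreeLT.2 ht)))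
    have hβ' := congrArg (C : ℂ → ℂ[X]) hβ
    have hγ' := congrArg (C : ℂ → ℂ[X]) hγ
    rw [h, h', h'']
    simp only [smul_eq_C_mul] at hX0 hX1 hX2 ⊢
    simp only [map_add, map_sub, map_mul, map_natCast, map_one, Nat.cast_add, Nat.cast_one,
      Nat.cast_ofNat, C_ofNat] at hX0 hX1 hX2 hβ' hγ' ⊢
    linear_combination hX2 + C (hahnCoeff a₁ a₂ b (n + 2) 1) * hX1 +
      C (hahnCoeff a₁ a₂ b (n + 2) 2) * hX0 - hβ' * descPochhammer ℂ (n + 2) -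
      hγ' * descPochhammer ℂ (n + 1)

/-- The recurrence coefficients computed with the Hahn polynomials. -/
theorem functional_X_mul_hahnPoly_mul_self (hc : ∀ k : ℤ, b - a₁ - a₂ ≠ k) (n : ℕ) :
    functional a₁ a₂ b (X * hahnPoly a₁ a₂ b n * hahnPoly a₁ a₂ b n) =
      hahnBeta a₁ a₂ b n * functional a₁ a₂ b (hahnPoly a₁ a₂ b n * hahnPoly a₁ a₂ b n) := by
  cases n with
  | zero =>
    rw [X_mul_hahnPoly_zero hc, add_mul, map_add, functional_hahnPoly_mul hc one_ne_zero, zero_add,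
      mul_assoc, ← smul_eq_C_mul, map_smul, smul_eq_mul]
  | succ n =>
    -- Pairing the remainder with `Hₙ₊₁` leaves only the `x` term and the `β` term.
    have hr := functional_hahnPoly_mul_of_degree_lt (n := n + 1) hc
      ((degree_remainder_lt hc n).trans (by exact_mod_cast n.lt_succ_self))
    rw [mul_sub, mul_sub, mul_sub, map_sub, map_sub, map_sub,
      functional_hahnPoly_mul hc (by omega : n + 1 ≠ n + 2), mul_left_comm _ (C _),
      mul_left_comm _ (C _), ← smul_eq_C_mul, ← smul_eq_C_mul, map_smul, map_smul,
      functional_hahnPoly_mul hc n.succ_ne_self, smul_zero, smul_eq_mul, sub_zero, sub_zero] at hr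
    rw [mul_comm]
    exact sub_eq_zero.1 hr

/-- The remainder is paired with `Hₙ` here, which needs its degree to be less than `n`; only the `x`
term and the `γ` term survive. -/
theorem functional_X_mul_hahnPoly_succ_mul (hc : ∀ k : ℤ, b - a₁ - a₂ ≠ k) (n : ℕ) :
    functional a₁ a₂ b (X * hahnPoly a₁ a₂ b (n + 1) * hahnPoly a₁ a₂ b n) =
      hahnGamma a₁ a₂ b (n + 1) *
        functional a₁ a₂ b (hahnPoly a₁ a₂ b n * hahnPoly a₁ a₂ b n) := by
  have hr := functional_hahnPoly_mul_of_degree_lt hc (degree_remainder_lt hc n)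
  rw [mul_sub, mul_sub, mul_sub, map_sub, map_sub, map_sub,
    functional_hahnPoly_mul hc (by omega : n ≠ n + 2), mul_left_comm _ (C _),
    mul_left_comm _ (C _), ← smul_eq_C_mul, ← smul_eq_C_mul, map_smul, map_smul,
    functional_hahnPoly_mul hc n.succ_ne_self.symm, smul_zero, smul_eq_mul, sub_zero,
    sub_zero] at hr
  rw [mul_comm]
  exact sub_eq_zero.1 hr

theorem IsMonicOPS.recBeta_eq (hc : ∀ k : ℤ, b - a₁ - a₂ ≠ k) {N : ℕ∞} {P : ℕ → ℂ[X]}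
    (hP : IsMonicOPS (functional a₁ a₂ b) N P) {n : ℕ} (hn : (n : ℕ∞) ≤ N) :
    recBeta (functional a₁ a₂ b) P n = hahnBeta a₁ a₂ b n := by
  rw [recBeta, div_eq_iff (hP.norm_ne_zero n hn), hP.eq_hahnPoly hc hn,
    functional_X_mul_hahnPoly_mul_self hc]

theorem IsMonicOPS.recGamma_eq (hc : ∀ k : ℤ, b - a₁ - a₂ ≠ k) {N : ℕ∞} {P : ℕ → ℂ[X]}
    (hP : IsMonicOPS (functional a₁ a₂ b) N P) {n : ℕ} (hn : (n : ℕ∞) ≤ N) :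
    recGamma (functional a₁ a₂ b) P n = hahnGamma a₁ a₂ b n := by
  cases n with
  | zero => simp [recGamma, hahnGamma]
  | succ n =>
    have hn' : (n : ℕ∞) ≤ N := le_trans (by exact_mod_cast n.le_succ) hn
    rw [recGamma, div_eq_iff (hP.norm_ne_zero n hn'), hP.eq_hahnPoly hc hn, hP.eq_hahnPoly hc hn',
      functional_X_mul_hahnPoly_succ_mul hc]

/-- The remainder has degree less than `n` and is orthogonal to every `Hₘ` with `m < n`, so it
vanishes by nondegeneracy. The given sequence enters only through its nonzero norms. -/
theorem IsMonicOPS.X_mul_hahnPoly (hc : ∀ k : ℤ, b - a₁ - a₂ ≠ k) {N : ℕ∞} {P : ℕ → ℂ[X]}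
    (hP : IsMonicOPS (functional a₁ a₂ b) N P) {n : ℕ} (hn : (n : ℕ∞) ≤ N) :
    X * hahnPoly a₁ a₂ b (n + 1) = hahnPoly a₁ a₂ b (n + 2) +
      C (hahnBeta a₁ a₂ b (n + 1)) * hahnPoly a₁ a₂ b (n + 1) +
      C (hahnGamma a₁ a₂ b (n + 1)) * hahnPoly a₁ a₂ b n := by
  have hz := eq_zero_of_orthogonal (L := functional a₁ a₂ b) (P := hahnPoly a₁ a₂ b)
    (fun m _ => monic_hahnPoly m) (fun m _ => natDegree_hahnPoly m)
    (fun i _ j _ hij => functional_hahnPoly_mul hc hij) (fun m hm => ?_)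
    (degree_remainder_lt hc n) fun m hm => ?_
  · linear_combination hz
  · have hm' : (m : ℕ∞) ≤ N := le_trans (by exact_mod_cast hm.le) hn
    have := hP.norm_ne_zero m hm'
    rwa [hP.eq_hahnPoly hc hm'] at this
  · have hd : (X * hahnPoly a₁ a₂ b m).degree < ((n + 1 : ℕ) : WithBot ℕ) := by
      rw [degree_mul, degree_X, degree_eq_natDegree (monic_hahnPoly m).ne_zero, natDegree_hahnPoly]
      exact_mod_cast (by omega : 1 + m < n + 1)
    have h1 := functional_hahnPoly_mul_of_degree_lt hc hd
    rw [sub_mul, sub_mul, sub_mul, map_sub, map_sub, map_sub, mul_assoc (C _), mul_assoc (C _),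
      ← smul_eq_C_mul, ← smul_eq_C_mul, map_smul, map_smul,
      functional_hahnPoly_mul hc (by omega : n + 2 ≠ m),
      functional_hahnPoly_mul hc (by omega : n + 1 ≠ m),
      functional_hahnPoly_mul hc (by omega : n ≠ m), mul_comm X, mul_assoc, h1]
    simp

end Recurrence

end HahnOP

/-- For the Hahn weight with `b ≠ -1, -2, …`, `Re(b - a₁ - a₂) > 0` and `b - a₁ - a₂ ≠ 1, 2, …`:
the recurrence coefficients of every (finite or infinite) monic orthogonal polynomial sequence with
respect to the moment functional of the weight. -/
theorem mainTheorem3 (a₁ a₂ b : ℂ) (hb : ∀ k : ℕ, b ≠ -((k : ℂ) + 1))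
    (hre : 0 < (b - a₁ - a₂).re) (hc : ∀ k : ℕ, b - a₁ - a₂ ≠ (k : ℂ) + 1)
    (N : ℕ∞) (P : ℕ → Polynomial ℂ)
    (hP : HahnOP.IsMonicOPS (HahnOP.functional a₁ a₂ b) N P) :
    (∀ n : ℕ, (n : ℕ∞) ≤ N →
      HahnOP.recBeta (HahnOP.functional a₁ a₂ b) P n =
        ((b + 2 - a₁ - a₂) * a₁ * a₂ - n * (a₁ + a₂ + b) * (n + a₁ + a₂ - b - 1)) /
          ((2 * n + a₁ + a₂ - b) * (2 * n + a₁ + a₂ - b - 2)) ∧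
      HahnOP.recGamma (HahnOP.functional a₁ a₂ b) P n =
        -n * ((n + a₁ - 1) * (n + a₂ - 1) * (n + a₁ - b - 1) /
            ((2 * n + a₁ + a₂ - b - 1) * (2 * n + a₁ + a₂ - b - 3))) *
          ((n + a₂ - b - 1) * (n + a₁ + a₂ - b - 2) / (2 * n + a₁ + a₂ - b - 2) ^ 2)) ∧
    (∀ n : ℕ, ((n + 1 : ℕ) : ℕ∞) ≤ N →
      Polynomial.X * P n = P (n + 1) +
        Polynomial.C (HahnOP.recBeta (HahnOP.functional a₁ a₂ b) P n) * P n +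
        Polynomial.C (HahnOP.recGamma (HahnOP.functional a₁ a₂ b) P n) * P (n - 1)) := by

  -- A positive real part excludes the integers `≤ 0`, and `hc` excludes the positive ones.
  have hc' : ∀ k : ℤ, b - a₁ - a₂ ≠ k := by
    intro k hk
    have hpos : 0 < k := by
      rw [hk, Complex.intCast_re] at hre
      exact_mod_cast hre
    obtain ⟨m, rfl⟩ : ∃ m : ℕ, k = m + 1 := ⟨(k - 1).toNat, by omega⟩
    exact hc m (by rw [hk]; push_cast; rfl)
  refine ⟨fun n hn => ⟨hP.recBeta_eq hc' hn, hP.recGamma_eq hc' hn⟩, fun n hn => ?_⟩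
  have hn' : (n : ℕ∞) ≤ N := le_trans (by exact_mod_cast n.le_succ) hn
  rw [hP.recBeta_eq hc' hn', hP.recGamma_eq hc' hn', hP.eq_hahnPoly hc' hn,
    hP.eq_hahnPoly hc' hn']
  cases n with
  -- With truncated subtraction `P (0 - 1)` is `P 0`, which is harmless because `γ₀ = 0`.
  | zero => simp [HahnOP.X_mul_hahnPoly_zero hc', HahnOP.hahnGamma]
  | succ n =>
    have hn'' : (n : ℕ∞) ≤ N := le_trans (by exact_mod_cast n.le_succ) hn'
    rw [Nat.add_sub_cancel, hP.eq_hahnPoly hc' hn'']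
    exact hP.X_mul_hahnPoly hc' hn''
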